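/- **Setting.** Let $I$ be a finite set of cadets, $B$ a finite set of branches, and $T=\{t^0,t^+\}$ the set of costs (base cost, increased cost). Branch $b$ has $q_b$ positions, of which at most $q_b^+\le q_b$ can be assigned at cost $t^+$; put $q_b^0=q_b-q_b^+$. Let $\mathcal Q$ be the set of strict linear orders $\succ$ on $(B\times T)\cup\{\emptyset\}$ with $(b,t^0)\succ(b,t^+)$ for all $b$; $\succeq$ is the weak version of $\succ$. Every branch $b$ has a baseline priority order $\pi_b$, a strict linear order on $I$. A BRADSO policy $\omega_b^+$ for $b$ is a strict linear order on $I\times T$ such that $(i,t)\,\omega_b^+\,(j,t)\iff i\,\pi_b\,j$ and $(i,t^+)\,\omega_b^+\,(i,t^0)$ for all $i,j,t$. An allocation is a set $X\subseteq I\times B\times T$ of contracts with at most one contract per cadet, at most $q_b$ contracts with branch $b$, and at most $q_b^+$ contracts with branch $b$ and cost $t^+$, for every $b$. The assignment of $i$ is $X_i=(b,t)$ if $(i,b,t)\in X$, and $X_i=\emptyset$ if $i$ has no contract in $X$. A direct mechanism $\varphi$ maps every profile $\succ\,\in\mathcal Q^{I}$ to an allocation $\varphi(\succ)$, and $\varphi_i(\succ)=\varphi(\succ)_i$.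 It satisfies * *individual rationality* if, for every profile $\succ$ and $X=\varphi(\succ)$: $X_i\succeq_i\emptyset$ for all $i$; * *non-wastefulness* if, for every $\succ$, $X=\varphi(\succ)$, $b$ and $i$: whenever fewer than $q_b$ contracts of $X$ have branch $b$ and $X_i=\emptyset$, then $\emptyset\succ_i(b,t^0)$; * *enforcement of the BRADSO policy* if, for every $\succ$, $X=\varphi(\succ)$, $b$, $i$ and $j$: (1) $X_i=(b,t^+)$ and $(b,t^0)\succ_j X_j$ imply $(i,t^+)\,\omega_b^+\,(j,t^0)$; (2) $X_j=(b,t^0)$, $(b,t^+)\succ_i X_i$ and $(i,t^+)\,\omega_b^+\,(j,t^0)$ imply $|\{i':X_{i'}=(b,t^+)\}|=q_b^+$; * *strategy-proofness* if $\varphi_i(\succ)\succeq_i\varphi_i(\succ_i',\succ_{-i})$ for all $\succ$, $i$ and $\succ_i'\,\in\mathcal Q$; * *no priority reversals* if, for every $\succ$, $X=\varphi(\succ)$, $i$, $j$, $b$ and $t$: $X_j=(b,t)$ and $X_j\succ_i X_i$ imply $j\,\pi_b\,i$. **Choice rule $\mathcal C_b^{BR}$.** Let $\omega_b^0$ be the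 order on $I\times T$ that ranks cadets by $\pi_b$ and ranks $(i,t^0)$ above $(i,t^+)$ for every $i$. Let $X$ be a set of contracts with branch $b$ that contains $(i,b,t^0)$ whenever it contains $(i,b,t^+)$. If fewer than $q_b^0$ distinct cadets have contracts in $X$, choose all contracts in $X$ with cost $t^0$. Otherwise let $X_1$ be the set of the $q_b^0$ highest $\omega_b^0$-priority contracts in $X$ with distinct cadets, and let $Y$ be the set of contracts in $X\setminus X_1$ whose cadets have no contract in $X_1$. If fewer than $q_b^+$ distinct cadets have contracts in $Y$, choose $X_1$ together with all contracts in $Y$ with cost $t^0$; otherwise choose $X_1\cup X_2$, where $X_2$ is the set of the $q_b^+$ highest $\omega_b^+$-priority contracts in $Y$ with distinct cadets. **COM-BRADSO.** Fix a strict linear order $\pi$ on $I$. Given $\succ\,\in\mathcal Q^I$, start with no contract available or rejected. At each step, among the cadets none of whose contracts is currently held and who have a contract preferred to $\emptyset$ that has not yet been rejected, the $\pi$-highest one proposes her most preferred such contract $x$. It is added to the set of contracts available to its branch $b$; the branch then holds the contracts that $\mathcal C_b^{BR}$ chooses from its available contracts (all contracts ever proposed to it) and rejects its other available contracts. The procedure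 ends when there is no such cadet. The set of contracts then held by the branches is $\phi^{COM-BR}(\succ)$. **Theorem.** Fix baseline priority orders $(\pi_b)_{b\in B}$ and BRADSO policies $(\omega_b^+)_{b\in B}$. For every linear order $\pi$ on $I$, $\phi^{COM-BR}$ is a well-defined direct mechanism (its outcome is always an allocation), and a direct mechanism $\varphi$ satisfies individual rationality, non-wastefulness, enforcement of the BRADSO policy, strategy-proofness and no priority reversals if and only if $\varphi=\phi^{COM-BR}$. -/

import Mathlib

namespace Bradso

/-- The two possible costs: the base cost `t⁰` and the increased cost `t⁺`. -/
inductive Cost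
  | base
  | increased
  deriving DecidableEq

instance : Fintype Cost where
  elems := {Cost.base, Cost.increased}
  complete t := by cases t <;> decide

/-- A strict linear order; `r.rel a b` means that `a` is ranked strictly above `b`. -/
structure Ranking (α : Type*) where
  rel : α → α → Prop
  strict_total : IsStrictTotalOrder α rel

/-- A strict preference over branch-cost pairs and remaining unmatched (`none`), where each
branch is strictly better at the base cost than at the increased cost. -/
structure Preference (B : Type*) extends Ranking (Option (B × Cost)) where
  base_better : ∀ b : B, rel (some (b, Cost.base)) (some (b, Cost.increased))

/-- The weak preference relation of a strict preference. -/
def Preference.weak {B : Type*} (p : Preference B) (a a' : Option (B × Cost)) : Prop :=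
  a = a' ∨ p.rel a a'

/-- A BRADSO policy for a branch with baseline priority order `π`. -/
structure Policy {I : Type*} (π : Ranking I) extends Ranking (I × Cost) where
  same_cost : ∀ (i j : I) (t : Cost), rel (i, t) (j, t) ↔ π.rel i j
  boost : ∀ i : I, rel (i, Cost.increased) (i, Cost.base)

/-- A contract `(i, b, t)` of a cadet, a branch and a cost. -/
abbrev Contract (I B : Type*) := I × B × Cost

namespace Contract

variable {I B : Type*}

abbrev cadet (x : Contract I B) : I := x.1

abbrev branch (x : Contract I B) : B := x.2.1

abbrev cost (x : Contract I B) : Cost := x.2.2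

end Contract

section Allocations

variable {I B : Type*} [DecidableEq I] [DecidableEq B]

/-- The feasibility conditions on a set of contracts: at most one contract for each cadet, at
most `q b` contracts for branch `b`, at most `qPlus b` of them at the increased cost. -/
structure IsAllocation (q qPlus : B → ℕ) (X : Finset (Contract I B)) : Prop where
  cadet_le : ∀ i : I, (X.filter fun x => x.cadet = i).card ≤ 1
  branch_le : ∀ b : B, (X.filter fun x => x.branch = b).card ≤ q b
  increased_le : ∀ b : B,
    (X.filter fun x => x.branch = b ∧ x.cost = Cost.increased).card ≤ qPlus b

/-- Allocations. -/
def Allocation (I : Type*) {B : Type*} [DecidableEq I] [DecidableEq B] (q qPlus : B → ℕ) :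
    Type _ :=
  {X : Finset (Contract I B) // IsAllocation q qPlus X}

open Classical in
/-- The assignment `X_i` of cadet `i`: the pair `(b, t)` with `(i, b, t) ∈ X` (there is at most
one), or `none` if the cadet has no contract in `X`. -/
noncomputable def Allocation.assign {q qPlus : B → ℕ} (X : Allocation I q qPlus) (i : I) :
    Option (B × Cost) :=
  if h : ∃ a : B × Cost, (i, a) ∈ X.1 then some h.choose else none

/-- A direct mechanism selects an allocation for each profile of reported preferences. -/
abbrev DirectMechanism (I : Type*) {B : Type*} [DecidableEq I] [DecidableEq B]
    (q qPlus : B → ℕ) : Type _ :=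
  (I → Preference B) → Allocation I q qPlus

variable {q qPlus : B → ℕ}

namespace Allocation

def IndividuallyRational (P : I → Preference B) (X : Allocation I q qPlus) : Prop :=
  ∀ i : I, (P i).weak (X.assign i) none

def NonWasteful (P : I → Preference B) (X : Allocation I q qPlus) : Prop :=
  ∀ (b : B) (i : I),
    (X.1.filter fun x => x.branch = b).card < q b → X.assign i = none →
      (P i).rel none (some (b, Cost.base))

def NoPriorityReversals (π : B → Ranking I) (P : I → Preference B)
    (X : Allocation I q qPlus) : Prop :=
  ∀ (i j : I) (b : B) (t : Cost),
    X.assign j = some (b, t) → (P i).rel (X.assign j) (X.assign i) → (π b).rel j i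

/-- Enforcement of the BRADSO policy: the two parts are the two conditions of the axiom. -/
def EnforcesPolicy [Fintype I] {π : B → Ranking I} (ω : ∀ b, Policy (π b))
    (P : I → Preference B) (X : Allocation I q qPlus) : Prop :=
  ∀ (b : B) (i j : I),
    (X.assign i = some (b, Cost.increased) →
      (P j).rel (some (b, Cost.base)) (X.assign j) →
        (ω b).rel (i, Cost.increased) (j, Cost.base)) ∧
    (X.assign j = some (b, Cost.base) →
      (P i).rel (some (b, Cost.increased)) (X.assign i) →
      (ω b).rel (i, Cost.increased) (j, Cost.base) →
        (Finset.univ.filter fun k : I => X.assign k = some (b, Cost.increased)).card = qPlus b)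

end Allocation

namespace DirectMechanism

def IndividuallyRational (φ : DirectMechanism I q qPlus) : Prop :=
  ∀ P : I → Preference B, (φ P).IndividuallyRational P

def NonWasteful (φ : DirectMechanism I q qPlus) : Prop :=
  ∀ P : I → Preference B, (φ P).NonWasteful P

def NoPriorityReversals (π : B → Ranking I) (φ : DirectMechanism I q qPlus) : Prop :=
  ∀ P : I → Preference B, (φ P).NoPriorityReversals π P

def EnforcesPolicy [Fintype I] {π : B → Ranking I} (ω : ∀ b, Policy (π b))
    (φ : DirectMechanism I q qPlus) : Prop :=
  ∀ P : I → Preference B, (φ P).EnforcesPolicy ω P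

def StrategyProof (φ : DirectMechanism I q qPlus) : Prop :=
  ∀ (P : I → Preference B) (i : I) (p : Preference B),
    (P i).weak ((φ P).assign i) ((φ (Function.update P i p)).assign i)

end DirectMechanism

end Allocations

section ChoiceRule

variable {I B : Type*} [DecidableEq I] [DecidableEq B]

/-- The native priority order: cadets are ranked by `π`, and each cadet's base cost pair is
ranked directly above her increased cost pair. -/
def nativeRel (π : Ranking I) (a a' : I × Cost) : Prop :=
  π.rel a.1 a'.1 ∨ (a.1 = a'.1 ∧ a.2 = Cost.base ∧ a'.2 = Cost.increased)

open Classical in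
/-- The contracts of `X` that have the highest `w`-priority among all contracts of the same
cadet in `X`. -/
noncomputable def bestPerCadet (w : I × Cost → I × Cost → Prop) (X : Finset (Contract I B)) :
    Finset (Contract I B) :=
  X.filter fun x => ∀ y ∈ X, y.cadet = x.cadet → ¬ w (y.cadet, y.cost) (x.cadet, x.cost)

open Classical in
/-- The `n` highest `w`-priority contracts of `X` with distinct cadets (all contracts of `X`
have the same branch). -/
noncomputable def topDistinct (w : I × Cost → I × Cost → Prop) (n : ℕ)
    (X : Finset (Contract I B)) : Finset (Contract I B) :=
  (bestPerCadet w X).filter fun x =>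
    ((bestPerCadet w X).filter fun y => w (y.cadet, y.cost) (x.cadet, x.cost)).card < n

/-- The number of distinct cadets with a contract in `X`. -/
def numCadets (X : Finset (Contract I B)) : ℕ := (X.image fun x => x.cadet).card

/-- The contracts of `X` at the base cost. -/
def baseContracts (X : Finset (Contract I B)) : Finset (Contract I B) :=
  X.filter fun x => x.cost = Cost.base

/-- The contracts picked in Step 1 of the choice rule when it does not terminate there. -/
noncomputable def firstPick (π : Ranking I) (q0 : ℕ) (X : Finset (Contract I B)) :
    Finset (Contract I B) :=
  topDistinct (nativeRel π) q0 X

/-- The contracts under consideration in Step 2 of the choice rule. -/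
noncomputable def secondPool (π : Ranking I) (q0 : ℕ) (X : Finset (Contract I B)) :
    Finset (Contract I B) :=
  (X \ firstPick π q0 X).filter fun x => (x.cadet, x.branch, Cost.base) ∉ firstPick π q0 X

/-- The choice rule of a branch with `q` positions, at most `qPlus` of them at the increased
cost, on a set `X` of contracts of this branch. -/
noncomputable def choice {π : Ranking I} (ω : Policy π) (q qPlus : ℕ)
    (X : Finset (Contract I B)) : Finset (Contract I B) :=
  if numCadets X < q - qPlus then
    baseContracts X
  else if numCadets (secondPool π (q - qPlus) X) < qPlus then
    firstPick π (q - qPlus) X ∪ baseContracts (secondPool π (q - qPlus) X)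
  else
    firstPick π (q - qPlus) X ∪ topDistinct ω.rel qPlus (secondPool π (q - qPlus) X)

end ChoiceRule

section CumulativeOffer

/-- A state of the cumulative offer procedure: the contracts proposed so far (those with branch
`b` are the contracts available to `b`), and the contracts that have been rejected so far. -/
structure State (I B : Type*) where
  available : Finset (Contract I B)
  rejected : Finset (Contract I B)

variable {I B : Type*} [DecidableEq I] [Fintype B] [DecidableEq B]
variable (q qPlus : B → ℕ) {π : B → Ranking I} (ω : ∀ b, Policy (π b))

/-- The contracts held by the branches when the contracts in `A` are available. -/
noncomputable def held (A : Finset (Contract I B)) : Finset (Contract I B) :=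
  Finset.univ.biUnion fun b =>
    choice (ω b) (q b) (qPlus b) (A.filter fun x => x.branch = b)

/-- An acceptable contract that has not been rejected, of a cadet for whom no contract is
currently held by any branch. -/
def CanOffer (P : I → Preference B) (s : State I B) (x : Contract I B) : Prop :=
  (∀ y ∈ held q qPlus ω s.available, y.cadet ≠ x.cadet) ∧
    (P x.cadet).rel (some x.2) none ∧ x ∉ s.rejected

/-- The procedure ends when no cadet without a held contract has an acceptable contract that has
not been rejected. -/
def Terminal (P : I → Preference B) (s : State I B) : Prop :=
  ∀ x : Contract I B, ¬ CanOffer q qPlus ω P s x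

/-- The contract proposed at state `s`: among the contracts that can be offered, it belongs to
the cadet that is ranked highest by `ρ`, and it is the one that this cadet likes best. -/
def IsNextOffer (ρ : Ranking I) (P : I → Preference B) (s : State I B) (x : Contract I B) :
    Prop :=
  CanOffer q qPlus ω P s x ∧
    ∀ y : Contract I B, CanOffer q qPlus ω P s y → y ≠ x →
      ρ.rel x.cadet y.cadet ∨
        (x.cadet = y.cadet ∧ (P x.cadet).rel (some x.2) (some y.2))

/-- There is at most one next offer. -/
theorem IsNextOffer.unique {q qPlus : B → ℕ} {π : B → Ranking I} {ω : ∀ b, Policy (π b)}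
    {ρ : Ranking I} {P : I → Preference B} {s : State I B}
    {x y : Contract I B} (hx : IsNextOffer q qPlus ω ρ P s x)
    (hy : IsNextOffer q qPlus ω ρ P s y) : x = y := by
  have hρ := ρ.strict_total
  have hP := (P x.cadet).strict_total
  by_contra hne
  rcases hx.2 y hy.1 (Ne.symm hne) with h1 | ⟨h1, h1'⟩ <;>
    rcases hy.2 x hx.1 hne with h2 | ⟨h2, h2'⟩
  · exact asymm_of ρ.rel h1 h2
  · rw [h2] at h1; exact irrefl_of ρ.rel _ h1
  · rw [h1] at h2; exact irrefl_of ρ.rel _ h2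
  · rw [← h1] at h2'; exact asymm_of (P x.cadet).rel h1' h2'

variable [Fintype I]

open Classical in
/-- One step of the procedure. The set that is added to the available contracts consists of the
single next offer, or is empty at a terminal state, which the step then leaves unchanged. -/
noncomputable def step (ρ : Ranking I) (P : I → Preference B) (s : State I B) : State I B :=
  let A := s.available ∪ Finset.univ.filter fun x => IsNextOffer q qPlus ω ρ P s x
  { available := A
    rejected := s.rejected ∪ (A \ held q qPlus ω A) }

/-- The state after `n` steps, starting with no proposals and no rejections. -/
noncomputable def stateAfter (ρ : Ranking I) (P : I → Preference B) (n : ℕ) : State I B :=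
  (step q qPlus ω ρ P)^[n] ⟨∅, ∅⟩

/-- The outcome of the COM-BRADSO mechanism: the contracts on hold when the procedure has ended.
No contract is proposed twice, so it has ended after as many steps as there are contracts; see
`terminal_stateAfter`. -/
noncomputable def comBradso (ρ : Ranking I) (P : I → Preference B) : Finset (Contract I B) :=
  held q qPlus ω
    (stateAfter q qPlus ω ρ P (Fintype.card (Contract I B))).available

variable {q qPlus ω}

/-- A state that is not terminal has a next offer. -/
theorem exists_isNextOffer {ρ : Ranking I} {P : I → Preference B} {s : State I B}
    (h : ¬ Terminal q qPlus ω P s) : ∃ x, IsNextOffer q qPlus ω ρ P s x := by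
  have hρ := ρ.strict_total
  have hP := fun i => (P i).strict_total
  let r : Contract I B → Contract I B → Prop := fun x y =>
    ρ.rel x.cadet y.cadet ∨ (x.cadet = y.cadet ∧ (P x.cadet).rel (some x.2) (some y.2))
  have hirr : Std.Irrefl r := ⟨by
    rintro x (hx | ⟨-, hx⟩)
    · exact irrefl_of ρ.rel _ hx
    · exact irrefl_of (P x.cadet).rel _ hx⟩
  have htr : IsTrans (Contract I B) r := ⟨by
    rintro ⟨i, a⟩ ⟨j, b⟩ ⟨k, c⟩ (h1 | ⟨h1, h1'⟩) (h2 | ⟨h2, h2'⟩)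
    · exact Or.inl (trans_of ρ.rel h1 h2)
    · dsimp only [Contract.cadet] at h1 h2; subst h2; exact Or.inl h1
    · dsimp only [Contract.cadet] at h1 h2; subst h1; exact Or.inl h2
    · dsimp only [Contract.cadet] at h1 h2 h1' h2'; subst h1; subst h2
      exact Or.inr ⟨rfl, trans_of (P i).rel h1' h2'⟩⟩
  have wf : WellFounded r := Finite.wellFounded_of_trans_of_irrefl r
  have hne : {x | CanOffer q qPlus ω P s x}.Nonempty := by
    simpa [Terminal, Set.Nonempty] using h
  obtain ⟨m, hm, hmin⟩ := wf.has_min _ hne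
  refine ⟨m, hm, fun y hy hne => ?_⟩
  have hnot : ¬ r y m := hmin y hy
  by_contra hcon
  have hnot' : ¬ r m y := hcon
  obtain ⟨i, a⟩ := m
  obtain ⟨j, b⟩ := y
  have hij : j = i := (hρ.toTrichotomous.trichotomous j i)
    (fun h => hnot (Or.inl h)) (fun h => hnot' (Or.inl h))
  subst hij
  have hab : some b = some a := ((hP j).toTrichotomous.trichotomous (some b) (some a))
    (fun h => hnot (Or.inr ⟨rfl, h⟩)) (fun h => hnot' (Or.inr ⟨rfl, h⟩))
  exact hne (by rw [Option.some.inj hab])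

/-- The procedure has ended after as many steps as there are contracts. -/
theorem terminal_stateAfter (ρ : Ranking I) (P : I → Preference B) :
    Terminal q qPlus ω P (stateAfter q qPlus ω ρ P (Fintype.card (Contract I B))) := by
  classical
  have key : ∀ n : ℕ,
      (∀ x ∈ (stateAfter q qPlus ω ρ P n).available,
        x ∈ (stateAfter q qPlus ω ρ P n).rejected ∨
          x ∈ held q qPlus ω (stateAfter q qPlus ω ρ P n).available) ∧
      (Terminal q qPlus ω P (stateAfter q qPlus ω ρ P n) ∨
        n ≤ (stateAfter q qPlus ω ρ P n).available.card) := by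
    intro n
    induction n with
    | zero => exact ⟨by simp [stateAfter], Or.inr (Nat.zero_le _)⟩
    | succ n ih =>
      have hs : stateAfter q qPlus ω ρ P (n + 1) =
          step q qPlus ω ρ P (stateAfter q qPlus ω ρ P n) := by
        simp [stateAfter, Function.iterate_succ_apply']
      rw [hs]
      generalize stateAfter q qPlus ω ρ P n = s at ih
      obtain ⟨ih1, ih2⟩ := ih
      constructor
      · intro x hx
        by_cases hh : x ∈ held q qPlus ω (step q qPlus ω ρ P s).available
        · exact Or.inr hh
        · exact Or.inl (Finset.mem_union_right _ (Finset.mem_sdiff.2 ⟨hx, hh⟩))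
      · by_cases ht : Terminal q qPlus ω P s
        · left
          have hempty : (Finset.univ.filter fun x => IsNextOffer q qPlus ω ρ P s x) = ∅ := by
            ext x
            simp only [Finset.mem_filter, Finset.mem_univ, true_and, Finset.notMem_empty,
              iff_false]
            exact fun hx => ht x hx.1
          have hav : (step q qPlus ω ρ P s).available = s.available := by
            simp [step, hempty]
          intro x hx
          refine ht x ⟨?_, hx.2.1, fun hr => hx.2.2 (Finset.mem_union_left _ hr)⟩
          have := hx.1
          rwa [hav] at this
        · right
          obtain ⟨x, hx⟩ := exists_isNextOffer (ρ := ρ) ht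
          have hn : n ≤ s.available.card := ih2.resolve_left ht
          have hxs : x ∉ s.available := by
            intro hxa
            rcases ih1 x hxa with h | h
            · exact hx.1.2.2 h
            · exact hx.1.1 x h rfl
          calc n + 1 ≤ (insert x s.available).card := by
                rw [Finset.card_insert_of_notMem hxs]; omega
            _ ≤ _ := Finset.card_le_card (by
                intro y hy
                rcases Finset.mem_insert.1 hy with rfl | hy
                · exact Finset.mem_union_right _ (by simpa using hx)
                · exact Finset.mem_union_left _ hy)
  obtain ⟨h1, h2⟩ := key (Fintype.card (Contract I B))
  rcases h2 with h2 | h2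
  · exact h2
  · generalize stateAfter q qPlus ω ρ P (Fintype.card (Contract I B)) = s at h1 h2
    have huniv : s.available = Finset.univ :=
      Finset.eq_univ_of_card _ (le_antisymm (Finset.card_le_univ _) h2)
    intro x hx
    rcases h1 x (by rw [huniv]; exact Finset.mem_univ x) with h | h
    · exact hx.2.2 h
    · exact hx.1 x h rfl

end CumulativeOffer

end Bradso

set_option linter.unusedSectionVars false

namespace Bradso

section Rankings

theorem Ranking.irrefl {α : Type*} (r : Ranking α) (a : α) : ¬ r.rel a a :=
  have := r.strict_total
  irrefl_of r.rel a

theorem Ranking.trans {α : Type*} (r : Ranking α) {a b c : α} (h : r.rel a b) (h' : r.rel b c) :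
    r.rel a c :=
  have := r.strict_total
  trans_of r.rel h h'

theorem Ranking.asymm {α : Type*} (r : Ranking α) {a b : α} (h : r.rel a b) : ¬ r.rel b a :=
  fun h' => r.irrefl a (r.trans h h')

theorem Ranking.total {α : Type*} (r : Ranking α) {a b : α} (h : a ≠ b) :
    r.rel a b ∨ r.rel b a := by
  by_contra! hc
  exact h (r.strict_total.toTrichotomous.trichotomous a b hc.1 hc.2)

/-- The native priority order as a ranking. -/
def nativeRanking {I : Type*} (π : Ranking I) : Ranking (I × Cost) where
  rel := nativeRel π
  strict_total :=
    { irrefl := by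
        rintro ⟨i, t⟩ (h | ⟨-, h1, h2⟩)
        · exact π.irrefl _ h
        · exact absurd (h1.symm.trans h2) (by simp)
      trans := by
        rintro ⟨i, t⟩ ⟨j, u⟩ ⟨k, v⟩ (h | ⟨h1, h2, h3⟩) (h' | ⟨h1', h2', h3'⟩)
        · exact Or.inl (π.trans h h')
        · dsimp only at h1'; subst h1'; exact Or.inl h
        · dsimp only at h1; subst h1; exact Or.inl h'
        · exact absurd (h3.symm.trans h2') (by simp)
      trichotomous := by
        rintro ⟨i, t⟩ ⟨j, u⟩ h h'
        have hij : i = j := by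
          by_contra hne
          rcases π.total hne with h1 | h1
          · exact h (Or.inl h1)
          · exact h' (Or.inl h1)
        subst hij
        cases t <;> cases u <;> simp_all [nativeRel] }

end Rankings

section Top

variable {I B : Type*} [DecidableEq B]

open Classical in
/-- The contracts of `S` that are, within their branch `b`, among the `n b` highest ranked. -/
noncomputable def topIn (W : B → Ranking (I × Cost)) (n : B → ℕ) (S : Finset (Contract I B)) :
    Finset (Contract I B) :=
  S.filter fun x => (S.filter fun y => y.branch = x.branch ∧
    (W x.branch).rel (y.cadet, y.cost) (x.cadet, x.cost)).card < n x.branch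

variable {W : B → Ranking (I × Cost)} {n : B → ℕ} {S S' : Finset (Contract I B)}
  {x y : Contract I B}

theorem topIn_subset : topIn W n S ⊆ S := Finset.filter_subset _ _

theorem notMem_topIn_of_subset (h : S ⊆ S') (hx : x ∈ S) (hxn : x ∉ topIn W n S) :
    x ∉ topIn W n S' := by
  classical
  intro hx'
  refine hxn (Finset.mem_filter.2 ⟨hx, lt_of_le_of_lt (Finset.card_le_card ?_)
    (Finset.mem_filter.1 hx').2⟩)
  exact Finset.filter_subset_filter _ h

theorem ext_of_branch (hb : x.branch = y.branch)
    (h : (x.cadet, x.cost) = (y.cadet, y.cost)) : x = y := by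
  exact Prod.ext (Prod.ext_iff.1 h).1 (Prod.ext hb (Prod.ext_iff.1 h).2)

theorem rel_of_mem_topIn (hx : x ∈ topIn W n S) (hy : y ∈ S) (hyn : y ∉ topIn W n S)
    (hb : x.branch = y.branch) :
    (W x.branch).rel (x.cadet, x.cost) (y.cadet, y.cost) := by
  classical
  by_contra hcon
  have hne : (x.cadet, x.cost) ≠ (y.cadet, y.cost) := by
    intro h
    exact hyn (ext_of_branch hb h ▸ hx)
  have hyx := ((W x.branch).total hne).resolve_left hcon
  refine hyn (Finset.mem_filter.2 ⟨hy, lt_of_le_of_lt (Finset.card_le_card ?_)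
    (hb ▸ (Finset.mem_filter.1 hx).2)⟩)
  intro z hz
  rw [Finset.mem_filter] at hz ⊢
  rw [← hb] at hz ⊢
  exact ⟨hz.1, hz.2.1, (W x.branch).trans hz.2.2 hyx⟩

theorem card_topIn (b : B) :
    ((topIn W n S).filter fun x => x.branch = b).card =
      min (n b) (S.filter fun x => x.branch = b).card := by
  classical
  set Sb := S.filter fun x => x.branch = b with hSb
  let f : Contract I B → ℕ := fun x =>
    (Sb.filter fun y => (W b).rel (y.cadet, y.cost) (x.cadet, x.cost)).card
  have hmono : ∀ x ∈ Sb, ∀ y ∈ Sb, (W b).rel (x.cadet, x.cost) (y.cadet, y.cost) →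
      f x < f y := by
    intro x hx y hy h
    refine Finset.card_lt_card (Finset.ssubset_iff_of_subset ?_ |>.2 ⟨x, ?_, ?_⟩)
    · intro z hz
      rw [Finset.mem_filter] at hz ⊢
      exact ⟨hz.1, (W b).trans hz.2 h⟩
    · exact Finset.mem_filter.2 ⟨hx, h⟩
    · intro hxx
      exact (W b).irrefl _ (Finset.mem_filter.1 hxx).2
  have hinj : Set.InjOn f Sb := by
    intro x hx y hy hxy
    by_contra hne
    have hb : x.branch = y.branch :=
      (Finset.mem_filter.1 hx).2.trans (Finset.mem_filter.1 hy).2.symm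
    rcases (W b).total (fun h => hne (ext_of_branch hb h)) with h | h
    · exact (hmono x hx y hy h).ne hxy
    · exact (hmono y hy x hx h).ne hxy.symm
  have himage : Sb.image f = Finset.range Sb.card := by
    refine Finset.eq_of_subset_of_card_le ?_ ?_
    · intro k hk
      obtain ⟨x, hx, rfl⟩ := Finset.mem_image.1 hk
      refine Finset.mem_range.2 (Finset.card_lt_card ?_)
      refine (Finset.ssubset_iff_of_subset (Finset.filter_subset _ _)).2 ⟨x, hx, fun h => ?_⟩
      exact (W b).irrefl _ (Finset.mem_filter.1 h).2
    · rw [Finset.card_range, Finset.card_image_of_injOn hinj]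
  have htop : (topIn W n S).filter (fun x => x.branch = b) = Sb.filter fun x => f x < n b := by
    ext x
    simp only [topIn, Finset.mem_filter, hSb, f, Finset.filter_filter]
    constructor
    · rintro ⟨h1, h2, rfl⟩
      exact ⟨h1, rfl, h2⟩
    · rintro ⟨h1, rfl, h2⟩
      exact ⟨h1, h2, rfl⟩
  have himage' : (Sb.filter fun x => f x < n b).image f =
      (Finset.range Sb.card).filter fun k => k < n b := by
    rw [← himage, Finset.filter_image]
  rw [htop, ← Finset.card_image_of_injOn (hinj.mono (Finset.coe_subset.2 (Finset.filter_subset _ _))), himage']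
  have : (Finset.range Sb.card).filter (fun k => k < n b) = Finset.range (min (n b) Sb.card) := by
    ext k
    simp [and_comm]
  rw [this, Finset.card_range]

theorem card_topIn_of_notMem (hx : x ∈ S) (hxn : x ∉ topIn W n S) :
    ((topIn W n S).filter fun y => y.branch = x.branch).card = n x.branch := by
  classical
  rw [card_topIn]
  refine min_eq_left ?_
  have h : n x.branch ≤ _ := not_lt.1 fun h => hxn (Finset.mem_filter.2 ⟨hx, h⟩)
  refine h.trans (Finset.card_le_card fun y hy => ?_)
  rw [Finset.mem_filter] at hy ⊢
  exact ⟨hy.1, hy.2.1⟩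

end Top

section Completion

variable {I B : Type*} [DecidableEq I] [DecidableEq B]
variable (q qPlus : B → ℕ) {π : B → Ranking I} (ω : ∀ b, Policy (π b))

/-- The base cost contracts that receive a position in the first part of the choice rule. -/
noncomputable def firstRound (π : B → Ranking I) (A : Finset (Contract I B)) :
    Finset (Contract I B) :=
  topIn (fun b => nativeRanking (π b)) (fun b => q b - qPlus b) (baseContracts A)

/-- The contracts that receive a position in the second part of the completed choice rule. -/
noncomputable def secondRound (A : Finset (Contract I B)) : Finset (Contract I B) :=
  topIn (fun b => (ω b).toRanking) qPlus (A \ firstRound q qPlus π A)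

/-- The completed choice rule, which may choose several contracts of the same cadet. -/
noncomputable def complete (A : Finset (Contract I B)) : Finset (Contract I B) :=
  firstRound q qPlus π A ∪ secondRound q qPlus ω A

/-- The contracts that the completed choice rule rejects. -/
noncomputable def rejects (A : Finset (Contract I B)) : Finset (Contract I B) :=
  A \ complete q qPlus ω A

variable {q qPlus ω} {A A' : Finset (Contract I B)} {x y : Contract I B}

theorem mem_baseContracts : x ∈ baseContracts A ↔ x ∈ A ∧ x.cost = Cost.base := by
  simp [baseContracts]

theorem firstRound_subset : firstRound q qPlus π A ⊆ baseContracts A := topIn_subset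

theorem secondRound_subset : secondRound q qPlus ω A ⊆ A \ firstRound q qPlus π A :=
  topIn_subset

theorem complete_subset : complete q qPlus ω A ⊆ A :=
  Finset.union_subset (firstRound_subset.trans (Finset.filter_subset _ _))
    (secondRound_subset.trans Finset.sdiff_subset)

theorem mem_rejects : x ∈ rejects q qPlus ω A ↔ x ∈ A ∧ x ∉ complete q qPlus ω A :=
  Finset.mem_sdiff

theorem mem_rejects_iff : x ∈ rejects q qPlus ω A ↔
    x ∈ A \ firstRound q qPlus π A ∧ x ∉ secondRound q qPlus ω A := by
  simp only [mem_rejects, complete, Finset.mem_union, Finset.mem_sdiff, not_or, and_assoc]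

theorem rejects_subset : rejects q qPlus ω A ⊆ A := Finset.sdiff_subset

theorem sdiff_firstRound_mono (h : A ⊆ A') :
    A \ firstRound q qPlus π A ⊆ A' \ firstRound q qPlus π A' := by
  intro x hx
  rw [Finset.mem_sdiff] at hx ⊢
  refine ⟨h hx.1, fun hx' => ?_⟩
  have hb := mem_baseContracts.1 (firstRound_subset hx')
  exact notMem_topIn_of_subset (Finset.filter_subset_filter _ h)
    (mem_baseContracts.2 ⟨hx.1, hb.2⟩) hx.2 hx'

theorem rejects_mono (h : A ⊆ A') : rejects q qPlus ω A ⊆ rejects q qPlus ω A' := by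
  intro x hx
  rw [mem_rejects_iff] at hx ⊢
  exact ⟨sdiff_firstRound_mono h hx.1,
    notMem_topIn_of_subset (sdiff_firstRound_mono h) hx.1 hx.2⟩

theorem disjoint_rounds :
    Disjoint (firstRound q qPlus π A) (secondRound q qPlus ω A) :=
  Finset.disjoint_sdiff.mono_right secondRound_subset

theorem card_complete_branch_eq (b : B) :
    ((complete q qPlus ω A).filter fun x => x.branch = b).card =
      ((firstRound q qPlus π A).filter fun x => x.branch = b).card +
      ((secondRound q qPlus ω A).filter fun x => x.branch = b).card := by
  rw [complete, Finset.filter_union, Finset.card_union_of_disjoint]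
  exact disjoint_rounds.mono (Finset.filter_subset _ _) (Finset.filter_subset _ _)

theorem card_complete_branch (b : B) :
    ((complete q qPlus ω A).filter fun x => x.branch = b).card =
      min (min (q b - qPlus b) ((baseContracts A).filter fun x => x.branch = b).card + qPlus b)
        (A.filter fun x => x.branch = b).card := by
  rw [card_complete_branch_eq, secondRound, card_topIn]
  have h1 : ((firstRound q qPlus π A).filter fun x => x.branch = b).card =
      min (q b - qPlus b) ((baseContracts A).filter fun x => x.branch = b).card := card_topIn b
  have h2 : ((A \ firstRound q qPlus π A).filter fun x => x.branch = b).card =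
      (A.filter fun x => x.branch = b).card -
        ((firstRound q qPlus π A).filter fun x => x.branch = b).card := by
    rw [← Finset.card_sdiff_of_subset]
    · congr 1
      ext x
      simp only [Finset.mem_filter, Finset.mem_sdiff]
      tauto
    · exact Finset.filter_subset_filter _ (firstRound_subset.trans (Finset.filter_subset _ _))
  have h3 : ((firstRound q qPlus π A).filter fun x => x.branch = b).card ≤
      (A.filter fun x => x.branch = b).card :=
    Finset.card_le_card (Finset.filter_subset_filter _
      (firstRound_subset.trans (Finset.filter_subset _ _)))
  omega

theorem card_complete_mono [Fintype B] (h : A ⊆ A') :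
    (complete q qPlus ω A).card ≤ (complete q qPlus ω A').card := by
  have key : ∀ Z : Finset (Contract I B), Z.card =
      ∑ b : B, (Z.filter fun x => x.branch = b).card := fun Z =>
    Finset.card_eq_sum_card_fiberwise fun x _ => Finset.mem_coe.2 (Finset.mem_univ x.branch)
  rw [key, key (complete q qPlus ω A')]
  refine Finset.sum_le_sum fun b _ => ?_
  rw [card_complete_branch, card_complete_branch]
  have h1 := Finset.card_le_card (Finset.filter_subset_filter (fun x => x.branch = b) h)
  have h2 : ((baseContracts A).filter fun x => x.branch = b).card ≤
      ((baseContracts A').filter fun x => x.branch = b).card :=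
    Finset.card_le_card (Finset.filter_subset_filter _ (Finset.filter_subset_filter _ h))
  omega

theorem card_complete_of_mem_rejects (hq : ∀ b, qPlus b ≤ q b) {i : I} {b : B}
    (h : (i, b, Cost.base) ∈ rejects q qPlus ω A) :
    ((complete q qPlus ω A).filter fun x => x.branch = b).card = q b := by
  rw [mem_rejects_iff] at h
  have h1 : ((firstRound q qPlus π A).filter fun x => x.branch = b).card = q b - qPlus b :=
    card_topIn_of_notMem (x := (i, b, Cost.base))
      (mem_baseContracts.2 ⟨(Finset.mem_sdiff.1 h.1).1, rfl⟩) (Finset.mem_sdiff.1 h.1).2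
  have h2 : ((secondRound q qPlus ω A).filter fun x => x.branch = b).card = qPlus b :=
    card_topIn_of_notMem (x := (i, b, Cost.base)) h.1 h.2
  have := hq b
  rw [card_complete_branch_eq]
  omega

theorem card_le_numCadets {Z Y : Finset (Contract I B)} (h : Z ⊆ Y)
    (hinj : ∀ x ∈ Z, ∀ y ∈ Z, x.cadet = y.cadet → x = y) : Z.card ≤ numCadets Y := by
  rw [numCadets, ← Finset.card_image_of_injOn (s := Z) (f := fun x : Contract I B => x.cadet)
    (fun x hx y hy => hinj x hx y hy)]
  exact Finset.card_le_card (Finset.image_subset_image h)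

theorem nativeRel_of_cost_eq {p : Ranking I} {i j : I} {t : Cost}
    (h : nativeRel p (i, t) (j, t)) : p.rel i j := by
  rcases h with h | ⟨-, h1, h2⟩
  · exact h
  · exact absurd (h1.symm.trans h2) (by simp)

theorem firstPick_eq
    (hA : ∀ i b, (i, b, Cost.increased) ∈ A → (i, b, Cost.base) ∈ rejects q qPlus ω A) (b : B) :
    firstPick (π b) (q b - qPlus b) (A.filter fun x => x.branch = b) =
      (firstRound q qPlus π A).filter fun x => x.branch = b := by
  classical
  have hbest : bestPerCadet (nativeRel (π b)) (A.filter fun x => x.branch = b) =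
      (baseContracts A).filter fun x => x.branch = b := by
    ext ⟨i, c, t⟩
    simp only [bestPerCadet, Finset.mem_filter, mem_baseContracts]
    constructor
    · rintro ⟨⟨hx, rfl⟩, hbest⟩
      refine ⟨⟨hx, ?_⟩, rfl⟩
      cases t with
      | base => rfl
      | increased =>
        exact absurd (Or.inr ⟨rfl, rfl, rfl⟩)
          (hbest (i, c, Cost.base) ⟨rejects_subset (hA i c hx), rfl⟩ rfl)
    · rintro ⟨⟨hx, ht⟩, rfl⟩
      refine ⟨⟨hx, rfl⟩, ?_⟩
      rintro ⟨j, d, u⟩ - hj (h | ⟨-, -, h⟩)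
      · cases hj
        exact (π _).irrefl _ h
      · exact absurd (ht.symm.trans h) (by simp)
  ext x
  simp only [firstPick, topDistinct, hbest, firstRound, topIn, Finset.mem_filter,
    Finset.filter_filter]
  constructor
  · rintro ⟨h1, rfl, h2⟩
    exact ⟨h1, h2, rfl⟩
  · rintro ⟨h1, h2, rfl⟩
    exact ⟨h1, rfl, h2⟩

theorem secondPool_eq
    (hA : ∀ i b, (i, b, Cost.increased) ∈ A → (i, b, Cost.base) ∈ rejects q qPlus ω A) (b : B) :
    secondPool (π b) (q b - qPlus b) (A.filter fun x => x.branch = b) =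
      (A \ firstRound q qPlus π A).filter fun x => x.branch = b := by
  ext ⟨i, c, t⟩
  simp only [secondPool, firstPick_eq hA, Finset.mem_filter, Finset.mem_sdiff]
  constructor
  · rintro ⟨⟨⟨h1, rfl⟩, h2⟩, -⟩
    exact ⟨⟨h1, fun h => h2 ⟨h, rfl⟩⟩, rfl⟩
  · rintro ⟨⟨h1, h2⟩, rfl⟩
    refine ⟨⟨⟨h1, rfl⟩, fun h => h2 h.1⟩, fun h => ?_⟩
    cases t with
    | base => exact h2 h.1
    | increased => exact (Finset.mem_sdiff.1 (mem_rejects_iff.1 (hA i c h1)).1).2 h.1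

theorem secondRound_cadet_inj
    (hA : ∀ i b, (i, b, Cost.increased) ∈ A → (i, b, Cost.base) ∈ rejects q qPlus ω A)
    (hx : x ∈ secondRound q qPlus ω A) (hy : y ∈ secondRound q qPlus ω A)
    (hb : x.branch = y.branch) (hc : x.cadet = y.cadet) : x = y := by
  obtain ⟨i, b, t⟩ := x
  obtain ⟨j, c, u⟩ := y
  cases hb
  cases hc
  have hmem : ∀ t, (i, b, t) ∈ secondRound q qPlus ω A → (i, b, t) ∈ A := fun t h =>
    (Finset.mem_sdiff.1 (secondRound_subset h)).1
  cases t <;> cases u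
  · rfl
  · exact absurd hx (mem_rejects_iff.1 (hA i b (hmem _ hy))).2
  · exact absurd hy (mem_rejects_iff.1 (hA i b (hmem _ hx))).2
  · rfl

theorem base_cadet_inj (hx : x.cost = Cost.base) (hy : y.cost = Cost.base)
    (hb : x.branch = y.branch) (hc : x.cadet = y.cadet) : x = y := by
  exact ext_of_branch hb (Prod.ext hc (hx.trans hy.symm))

theorem topDistinct_eq
    (hA : ∀ i b, (i, b, Cost.increased) ∈ A → (i, b, Cost.base) ∈ rejects q qPlus ω A) (b : B)
    (hn : qPlus b ≤ numCadets ((A \ firstRound q qPlus π A).filter fun x => x.branch = b)) :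
    topDistinct (ω b).rel (qPlus b)
        ((A \ firstRound q qPlus π A).filter fun x => x.branch = b) =
      (secondRound q qPlus ω A).filter fun x => x.branch = b := by
  classical
  set Y := (A \ firstRound q qPlus π A).filter fun x => x.branch = b with hY
  have hbest : (secondRound q qPlus ω A).filter (fun x => x.branch = b) ⊆
      bestPerCadet (ω b).rel Y := by
    rintro ⟨i, c, t⟩ hx
    rw [Finset.mem_filter] at hx
    obtain ⟨hx, hc⟩ := hx
    cases hc
    refine Finset.mem_filter.2 ⟨Finset.mem_filter.2 ⟨secondRound_subset hx, rfl⟩, ?_⟩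
    rintro ⟨j, d, u⟩ hy hj h
    rw [Finset.mem_filter] at hy
    obtain ⟨hy, hd⟩ := hy
    cases hd
    cases hj
    cases t <;> cases u
    · exact (ω c).irrefl _ h
    · exact (mem_rejects_iff.1 (hA i c (Finset.mem_sdiff.1 hy).1)).2 hx
    · exact (ω c).asymm h ((ω c).boost i)
    · exact (ω c).irrefl _ h
  have hcard : ((secondRound q qPlus ω A).filter fun x => x.branch = b).card = qPlus b := by
    have : ((secondRound q qPlus ω A).filter fun x => x.branch = b).card =
      min (qPlus b) Y.card := card_topIn b
    rw [this]
    exact min_eq_left (hn.trans Finset.card_image_le)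
  ext x
  constructor
  · intro hx
    obtain ⟨hxb, hxc⟩ := Finset.mem_filter.1 hx
    obtain ⟨hxY, hxb⟩ := Finset.mem_filter.1 (Finset.mem_filter.1 hxb).1
    refine Finset.mem_filter.2 ⟨?_, hxb⟩
    by_contra hxn
    refine absurd hxc (not_lt.2 (hcard.symm.le.trans (Finset.card_le_card fun y hy => ?_)))
    refine Finset.mem_filter.2 ⟨hbest hy, ?_⟩
    obtain ⟨hy, hyb⟩ := Finset.mem_filter.1 hy
    have := rel_of_mem_topIn hy hxY hxn (hyb.trans hxb.symm)
    rwa [hyb] at this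
  · intro hx
    refine Finset.mem_filter.2 ⟨hbest hx, ?_⟩
    obtain ⟨hx', rfl⟩ := Finset.mem_filter.1 hx
    refine lt_of_le_of_lt (Finset.card_le_card fun y hy => ?_) (Finset.mem_filter.1 hx').2
    rw [Finset.mem_filter] at hy ⊢
    have hyY := Finset.mem_filter.1 (Finset.mem_filter.1 hy.1).1
    exact ⟨hyY.1, hyY.2, hy.2⟩

/-- The choice rule agrees with its completion on sets that arise from truthful offers. -/
theorem choice_eq
    (hA : ∀ i b, (i, b, Cost.increased) ∈ A → (i, b, Cost.base) ∈ rejects q qPlus ω A) (b : B) :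
    choice (ω b) (q b) (qPlus b) (A.filter fun x => x.branch = b) =
      (complete q qPlus ω A).filter fun x => x.branch = b := by
  classical
  have base_of : ∀ Z ⊆ A, (∀ i, (i, b, Cost.base) ∈ rejects q qPlus ω A →
      (i, b, Cost.increased) ∈ Z → False) →
      baseContracts (Z.filter fun x => x.branch = b) = Z.filter fun x => x.branch = b := by
    intro Z hZ h
    refine Finset.filter_true_of_mem ?_
    rintro ⟨i, c, t⟩ hx
    rw [Finset.mem_filter] at hx
    obtain ⟨hx, hc⟩ := hx
    cases hc
    cases t with
    | base => rfl
    | increased => exact (h i (hA i c (hZ hx)) hx).elim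
  unfold choice
  split_ifs with h1 h2
  · have hfirst : ∀ x ∈ A, x.branch = b → x.cost = Cost.base → x ∈ firstRound q qPlus π A := by
      rintro x hx rfl ht
      refine Finset.mem_filter.2 ⟨mem_baseContracts.2 ⟨hx, ht⟩, lt_of_le_of_lt ?_ h1⟩
      refine card_le_numCadets ?_ ?_
      · intro y hy
        rw [Finset.mem_filter, mem_baseContracts] at hy
        exact Finset.mem_filter.2 ⟨hy.1.1, hy.2.1⟩
      · intro y hy z hz
        rw [Finset.mem_filter, mem_baseContracts] at hy hz
        exact base_cadet_inj hy.1.2 hz.1.2 (hy.2.1.trans hz.2.1.symm)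
    rw [base_of A subset_rfl]
    · ext x
      simp only [Finset.mem_filter]
      refine ⟨fun h => ⟨?_, h.2⟩, fun h => ⟨complete_subset h.1, h.2⟩⟩
      obtain ⟨i, c, t⟩ := x
      obtain ⟨hx, rfl⟩ := h
      cases t with
      | base => exact Finset.mem_union_left _ (hfirst _ hx rfl rfl)
      | increased =>
        have hr := hA i c hx
        exact absurd (hfirst _ (rejects_subset hr) rfl rfl)
          (Finset.mem_sdiff.1 (mem_rejects_iff.1 hr).1).2
    · intro i hr _
      exact (Finset.mem_sdiff.1 (mem_rejects_iff.1 hr).1).2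
        (hfirst _ (rejects_subset hr) rfl rfl)
  · rw [secondPool_eq hA] at h2 ⊢
    rw [firstPick_eq hA]
    have hbase : baseContracts ((A \ firstRound q qPlus π A).filter fun x => x.branch = b) =
        (A \ firstRound q qPlus π A).filter fun x => x.branch = b := by
      refine base_of _ Finset.sdiff_subset fun i hr _ => ?_
      have hc : ((secondRound q qPlus ω A).filter fun x => x.branch = b).card = qPlus b :=
        card_topIn_of_notMem (x := (i, b, Cost.base)) (mem_rejects_iff.1 hr).1
          (mem_rejects_iff.1 hr).2
      refine absurd h2 (not_lt.2 (hc.symm.le.trans (card_le_numCadets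
        (Finset.filter_subset_filter _ secondRound_subset) ?_)))
      intro x hx y hy
      rw [Finset.mem_filter] at hx hy
      exact secondRound_cadet_inj hA hx.1 hy.1 (hx.2.trans hy.2.symm)
    have hcard : ((A \ firstRound q qPlus π A).filter fun x => x.branch = b).card < qPlus b := by
      refine lt_of_le_of_lt (card_le_numCadets subset_rfl ?_) h2
      intro x hx y hy
      rw [← hbase, mem_baseContracts, Finset.mem_filter] at hx hy
      exact base_cadet_inj hx.2 hy.2 (hx.1.2.trans hy.1.2.symm)
    rw [hbase, complete, Finset.filter_union]
    congr 1
    refine Finset.Subset.antisymm ?_ (Finset.filter_subset_filter _ secondRound_subset)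
    intro x hx
    obtain ⟨hx', rfl⟩ := Finset.mem_filter.1 hx
    refine Finset.mem_filter.2 ⟨Finset.mem_filter.2 ⟨hx', lt_of_le_of_lt
      (Finset.card_le_card ?_) hcard⟩, rfl⟩
    intro y hy
    rw [Finset.mem_filter] at hy ⊢
    exact ⟨hy.1, hy.2.1⟩
  · rw [secondPool_eq hA] at h2 ⊢
    rw [firstPick_eq hA, topDistinct_eq hA b (not_lt.1 h2), complete, Finset.filter_union]

theorem held_eq_complete [Fintype B]
    (hA : ∀ i b, (i, b, Cost.increased) ∈ A → (i, b, Cost.base) ∈ rejects q qPlus ω A) :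
    held q qPlus ω A = complete q qPlus ω A := by
  ext x
  simp [held, choice_eq hA]

end Completion

section Offers

variable {I B : Type*} [DecidableEq I] [DecidableEq B]
variable {q qPlus : B → ℕ} {π : B → Ranking I} {ω : ∀ b, Policy (π b)}
variable {P : I → Preference B} {A A' : Finset (Contract I B)}

/-- Every contract in `A` is acceptable, and it was proposed after the better ones were rejected. -/
def Justified (q qPlus : B → ℕ) {π : B → Ranking I} (ω : ∀ b, Policy (π b))
    (P : I → Preference B) (A : Finset (Contract I B)) : Prop :=
  ∀ i a, (i, a) ∈ A → (P i).rel (some a) none ∧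
    ∀ a', (P i).rel (some a') (some a) → (i, a') ∈ rejects q qPlus ω A

/-- `A` contains every acceptable contract of a cadet all of whose better ones are rejected. -/
def OfferClosed (q qPlus : B → ℕ) {π : B → Ranking I} (ω : ∀ b, Policy (π b))
    (P : I → Preference B) (A : Finset (Contract I B)) : Prop :=
  ∀ i a, (P i).rel (some a) none →
    (∀ a', (P i).rel (some a') (some a) → (i, a') ∈ rejects q qPlus ω A) → (i, a) ∈ A

/-- `A` is the set of contracts proposed in the cumulative offer procedure. -/
structure IsOfferSet (q qPlus : B → ℕ) {π : B → Ranking I} (ω : ∀ b, Policy (π b))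
    (P : I → Preference B) (A : Finset (Contract I B)) : Prop where
  justified : Justified q qPlus ω P A
  exhausted : ∀ i a, (P i).rel (some a) none →
    (i, a) ∈ rejects q qPlus ω A ∨ ∃ a', (i, a') ∈ complete q qPlus ω A
  least : ∀ A', OfferClosed q qPlus ω P A' → A ⊆ A'

theorem Justified.base_mem_rejects (h : Justified q qPlus ω P A) (i : I) (b : B)
    (hi : (i, b, Cost.increased) ∈ A) : (i, b, Cost.base) ∈ rejects q qPlus ω A :=
  (h i _ hi).2 _ ((P i).base_better b)

theorem Justified.unique (h : Justified q qPlus ω P A) {i : I} {a a' : B × Cost}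
    (ha : (i, a) ∈ complete q qPlus ω A) (ha' : (i, a') ∈ complete q qPlus ω A) : a = a' := by
  by_contra hne
  rcases (P i).total (fun h => hne (Option.some.inj h)) with hr | hr
  · exact (mem_rejects.1 ((h i _ (complete_subset ha')).2 _ hr)).2 ha
  · exact (mem_rejects.1 ((h i _ (complete_subset ha)).2 _ hr)).2 ha'

theorem IsOfferSet.offerClosed (h : IsOfferSet q qPlus ω P A) : OfferClosed q qPlus ω P A := by
  intro i a ha hbetter
  rcases h.exhausted i a ha with hr | ⟨a', ha'⟩
  · exact rejects_subset hr
  · by_cases heq : a = a'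
    · exact heq ▸ complete_subset ha'
    · rcases (P i).total (fun h => heq (Option.some.inj h)) with hr | hr
      · exact rejects_subset ((h.justified i _ (complete_subset ha')).2 _ hr)
      · exact absurd ha' (mem_rejects.1 (hbetter _ hr)).2

section Procedure

variable [Fintype I] [Fintype B] {ρ : Ranking I}

theorem Justified.insert_offer (h : Justified q qPlus ω P A) {x : Contract I B}
    (hx : IsNextOffer q qPlus ω ρ P ⟨A, rejects q qPlus ω A⟩ x) :
    (∀ a', (P x.cadet).rel (some a') (some x.2) → (x.cadet, a') ∈ rejects q qPlus ω A) ∧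
      Justified q qPlus ω P (insert x A) := by
  have hbetter : ∀ a', (P x.cadet).rel (some a') (some x.2) →
      (x.cadet, a') ∈ rejects q qPlus ω A := by
    intro a' ha'
    by_contra hr
    rcases hx.2 (x.cadet, a') ⟨hx.1.1, (P x.cadet).trans ha' hx.1.2.1, hr⟩
      (fun h => (P x.cadet).irrefl (some a') (by rw [← h] at ha'; exact ha')) with h1 | ⟨-, h1⟩
    · exact ρ.irrefl _ h1
    · exact (P x.cadet).asymm h1 ha'
  refine ⟨hbetter, fun i a hia => ?_⟩
  rcases Finset.mem_insert.1 hia with rfl | hia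
  · exact ⟨hx.1.2.1, fun a' ha' => rejects_mono (Finset.subset_insert _ _) (hbetter a' ha')⟩
  · exact ⟨(h i a hia).1, fun a' ha' =>
      rejects_mono (Finset.subset_insert _ _) ((h i a hia).2 a' ha')⟩

theorem step_eq (h : Justified q qPlus ω P A) :
    ∃ A', A ⊆ A' ∧ step q qPlus ω ρ P ⟨A, rejects q qPlus ω A⟩ =
        ⟨A', rejects q qPlus ω A'⟩ ∧ Justified q qPlus ω P A' ∧
      ∀ Z, OfferClosed q qPlus ω P Z → A ⊆ Z → A' ⊆ Z := by
  classical
  have key : ∀ A', Justified q qPlus ω P A' → A ⊆ A' →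
      A ∪ Finset.univ.filter (fun x => IsNextOffer q qPlus ω ρ P ⟨A, rejects q qPlus ω A⟩ x)
        = A' → step q qPlus ω ρ P ⟨A, rejects q qPlus ω A⟩ = ⟨A', rejects q qPlus ω A'⟩ := by
    intro A' h' hsub hA'
    have hstep : step q qPlus ω ρ P ⟨A, rejects q qPlus ω A⟩ =
        ⟨A', rejects q qPlus ω A ∪ (A' \ held q qPlus ω A')⟩ := by
      rw [← hA']
      simp only [step]
    rw [hstep, held_eq_complete h'.base_mem_rejects]
    congr 1
    exact Finset.union_eq_right.2 (rejects_mono hsub)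
  by_cases hT : Terminal q qPlus ω P ⟨A, rejects q qPlus ω A⟩
  · refine ⟨A, subset_rfl, key A h subset_rfl ?_, h, fun Z _ hZ => hZ⟩
    rw [Finset.filter_false_of_mem (fun x _ hx => hT x hx.1), Finset.union_empty]
  · obtain ⟨x, hx⟩ := exists_isNextOffer (ρ := ρ) hT
    obtain ⟨hbetter, h'⟩ := h.insert_offer hx
    refine ⟨insert x A, Finset.subset_insert _ _, key _ h' (Finset.subset_insert _ _) ?_, h', ?_⟩
    · have : Finset.univ.filter
          (fun x => IsNextOffer q qPlus ω ρ P ⟨A, rejects q qPlus ω A⟩ x) = {x} := by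
        ext y
        simp only [Finset.mem_filter, Finset.mem_univ, true_and, Finset.mem_singleton]
        exact ⟨fun hy => hy.unique hx, fun hy => hy ▸ hx⟩
      rw [this, Finset.insert_eq, Finset.union_comm]
    · intro Z hZ hAZ
      refine Finset.insert_subset (hZ _ _ hx.1.2.1 fun a' ha' => ?_) hAZ
      exact rejects_mono hAZ (hbetter a' ha')

theorem stateAfter_eq (ρ : Ranking I) (P : I → Preference B) (n : ℕ) :
    ∃ A, stateAfter q qPlus ω ρ P n = ⟨A, rejects q qPlus ω A⟩ ∧ Justified q qPlus ω P A ∧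
      ∀ Z, OfferClosed q qPlus ω P Z → A ⊆ Z := by
  induction n with
  | zero =>
    refine ⟨∅, ?_, fun i a h => absurd h (Finset.notMem_empty _), fun Z _ => Finset.empty_subset Z⟩
    simp [stateAfter, rejects]
  | succ n ih =>
    obtain ⟨A, hA, hJ, hZ⟩ := ih
    obtain ⟨A', -, h1, h2, h3⟩ := step_eq (ρ := ρ) hJ
    refine ⟨A', ?_, h2, fun Z hc => h3 Z hc (hZ Z hc)⟩
    rw [← h1, ← hA, stateAfter, stateAfter, Function.iterate_succ_apply']

theorem exists_isOfferSet (ρ : Ranking I) (P : I → Preference B) :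
    ∃ A, IsOfferSet q qPlus ω P A ∧ comBradso q qPlus ω ρ P = complete q qPlus ω A := by
  have hT := terminal_stateAfter (q := q) (qPlus := qPlus) (ω := ω) ρ P
  obtain ⟨A, hA, hJ, hZ⟩ := stateAfter_eq (q := q) (qPlus := qPlus) (ω := ω) ρ P
    (Fintype.card (Contract I B))
  have hheld := held_eq_complete hJ.base_mem_rejects
  refine ⟨A, ⟨hJ, fun i a ha => ?_, hZ⟩, ?_⟩
  · rw [hA] at hT
    by_contra! hcon
    refine hT (i, a) ⟨?_, ha, hcon.1⟩
    rintro ⟨j, a'⟩ hy hj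
    rw [hheld] at hy
    cases hj
    exact hcon.2 a' hy
  · rw [comBradso, hA, hheld]

end Procedure

theorem isAllocation_complete (hq : ∀ b, qPlus b ≤ q b) (h : Justified q qPlus ω P A) :
    IsAllocation q qPlus (complete q qPlus ω A) where
  cadet_le i := by
    rw [Finset.card_le_one]
    rintro ⟨j, a⟩ hj ⟨k, a'⟩ hk
    rw [Finset.mem_filter] at hj hk
    obtain ⟨hj, rfl⟩ := hj
    obtain ⟨hk, hkj⟩ := hk
    cases hkj
    rw [h.unique hj hk]
  branch_le b := by
    have h1 : ((firstRound q qPlus π A).filter fun x => x.branch = b).card =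
      min (q b - qPlus b) _ := card_topIn b
    have h2 : ((secondRound q qPlus ω A).filter fun x => x.branch = b).card =
      min (qPlus b) _ := card_topIn b
    have := hq b
    rw [card_complete_branch_eq]
    omega
  increased_le b := by
    have h2 : ((secondRound q qPlus ω A).filter fun x => x.branch = b).card =
      min (qPlus b) _ := card_topIn b
    refine (Finset.card_le_card ?_).trans (h2.le.trans (min_le_left _ _))
    intro x hx
    obtain ⟨hx, hb, ht⟩ := Finset.mem_filter.1 hx
    refine Finset.mem_filter.2 ⟨?_, hb⟩
    refine (Finset.mem_union.1 hx).resolve_left fun h => ?_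
    exact absurd (ht.symm.trans (mem_baseContracts.1 (firstRound_subset h)).2) (by simp)

end Offers

section Restriction

variable {B : Type*}

open Classical in
/-- Acceptable pairs of a restricted preference come first, then `none`, then the others. -/
noncomputable def tier (S : Set (B × Cost)) : Option (B × Cost) → ℕ
  | none => 1
  | some a => if a ∈ S then 0 else 2

/-- The preference that agrees with `p` except that exactly the pairs in `S` are acceptable. -/
noncomputable def Preference.restrict (p : Preference B) (S : Set (B × Cost))
    (hS : ∀ b, (b, Cost.increased) ∈ S → (b, Cost.base) ∈ S) : Preference B where
  rel a b := tier S a < tier S b ∨ (tier S a = tier S b ∧ p.rel a b)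
  strict_total :=
    { irrefl := by
        rintro a (h | ⟨-, h⟩)
        · exact lt_irrefl _ h
        · exact p.irrefl _ h
      trans := by
        rintro a b c (h | ⟨h, hr⟩) (h' | ⟨h', hr'⟩)
        · exact Or.inl (h.trans h')
        · exact Or.inl (h' ▸ h)
        · exact Or.inl (h ▸ h')
        · exact Or.inr ⟨h.trans h', p.trans hr hr'⟩
      trichotomous := by
        intro a b h h'
        by_contra hne
        rcases lt_trichotomy (tier S a) (tier S b) with ht | ht | ht
        · exact h (Or.inl ht)
        · rcases p.total hne with hr | hr
          · exact h (Or.inr ⟨ht, hr⟩)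
          · exact h' (Or.inr ⟨ht.symm, hr⟩)
        · exact h' (Or.inl ht) }
  base_better b := by
    by_cases h1 : (b, Cost.increased) ∈ S
    · exact Or.inr ⟨by simp [tier, h1, hS b h1], p.base_better b⟩
    · by_cases h2 : (b, Cost.base) ∈ S
      · exact Or.inl (by simp [tier, h1, h2])
      · exact Or.inr ⟨by simp [tier, h1, h2], p.base_better b⟩

variable {p : Preference B} {S : Set (B × Cost)}
  {hS : ∀ b, (b, Cost.increased) ∈ S → (b, Cost.base) ∈ S} {a a' : B × Cost}

theorem restrict_rel_none : (p.restrict S hS).rel (some a) none ↔ a ∈ S := by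
  by_cases h : a ∈ S <;> simp [Preference.restrict, tier, h]

theorem restrict_rel_some (ha' : a' ∈ S) :
    (p.restrict S hS).rel (some a) (some a') ↔ a ∈ S ∧ p.rel (some a) (some a') := by
  by_cases h : a ∈ S <;> simp [Preference.restrict, tier, h, ha']

end Restriction

section Mechanism

variable {I B : Type*} [DecidableEq I] [DecidableEq B]
variable {q qPlus : B → ℕ}

theorem Allocation.assign_eq_some (X : Allocation I q qPlus) {i : I} {a : B × Cost} :
    X.assign i = some a ↔ (i, a) ∈ X.1 := by
  unfold Allocation.assign
  constructor
  · intro h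
    split_ifs at h with hex
    exact Option.some.inj h ▸ hex.choose_spec
  · intro h
    have hex : ∃ a : B × Cost, (i, a) ∈ X.1 := ⟨a, h⟩
    rw [dif_pos hex]
    have := Finset.card_le_one.1 (X.2.cadet_le i) (i, hex.choose)
      (Finset.mem_filter.2 ⟨hex.choose_spec, rfl⟩) (i, a) (Finset.mem_filter.2 ⟨h, rfl⟩)
    exact congrArg some (Prod.ext_iff.1 this).2

theorem Allocation.assign_eq_none (X : Allocation I q qPlus) {i : I} :
    X.assign i = none ↔ ∀ a, (i, a) ∉ X.1 := by
  simp [Option.eq_none_iff_forall_ne_some, X.assign_eq_some]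

theorem Allocation.card_filter_assign [Fintype I] (X : Allocation I q qPlus)
    (r : B × Cost → Prop) [DecidablePred r] [DecidablePred fun k => ∃ a, X.assign k = some a ∧ r a] :
    (X.1.filter fun x => r x.2).card =
      (Finset.univ.filter fun k => ∃ a, X.assign k = some a ∧ r a).card := by
  have himage : (X.1.filter fun x => r x.2).image (fun x => x.1) =
      Finset.univ.filter fun k => ∃ a, X.assign k = some a ∧ r a := by
    ext k
    simp only [Finset.mem_image, Finset.mem_filter, Finset.mem_univ, true_and, X.assign_eq_some]
    constructor
    · rintro ⟨⟨i, a⟩, ⟨h1, h2⟩, rfl⟩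
      exact ⟨a, h1, h2⟩
    · rintro ⟨a, h1, h2⟩
      exact ⟨(k, a), ⟨h1, h2⟩, rfl⟩
  rw [← himage, Finset.card_image_of_injOn]
  rintro ⟨i, a⟩ hx ⟨j, a'⟩ hy h
  cases h
  have h1 := X.assign_eq_some.2 (Finset.mem_filter.1 hx).1
  have h2 := X.assign_eq_some.2 (Finset.mem_filter.1 hy).1
  rw [Option.some.inj (h1.symm.trans h2)]

variable {π : B → Ranking I} {ω : ∀ b, Policy (π b)}
variable {P : I → Preference B} {A : Finset (Contract I B)} {X : Allocation I q qPlus}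

theorem IsOfferSet.individuallyRational (h : IsOfferSet q qPlus ω P A)
    (hX : X.1 = complete q qPlus ω A) : X.IndividuallyRational P := by
  intro i
  cases hi : X.assign i with
  | none => exact Or.inl rfl
  | some a =>
    rw [X.assign_eq_some, hX] at hi
    exact Or.inr (h.justified i a (complete_subset hi)).1

theorem IsOfferSet.mem_rejects_of_rel (h : IsOfferSet q qPlus ω P A)
    (hX : X.1 = complete q qPlus ω A) {i : I} {a : B × Cost}
    (ha : (P i).rel (some a) (X.assign i)) : (i, a) ∈ rejects q qPlus ω A := by
  cases hi : X.assign i with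
  | none =>
    rw [hi] at ha
    rw [X.assign_eq_none, hX] at hi
    rcases h.exhausted i a ha with hr | ⟨a', ha'⟩
    · exact hr
    · exact absurd ha' (hi a')
  | some a' =>
    rw [hi] at ha
    rw [X.assign_eq_some, hX] at hi
    exact (h.justified i a' (complete_subset hi)).2 a ha

theorem IsOfferSet.nonWasteful (hq : ∀ b, qPlus b ≤ q b) (h : IsOfferSet q qPlus ω P A)
    (hX : X.1 = complete q qPlus ω A) : X.NonWasteful P := by
  intro b i hcard hi
  by_contra hcon
  have hr : (P i).rel (some (b, Cost.base)) none := ((P i).total (by simp)).resolve_right hcon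
  have := card_complete_of_mem_rejects hq (h.mem_rejects_of_rel hX (hi ▸ hr))
  rw [hX] at hcard
  exact hcard.ne this

theorem firstRound_rel {i j : I} {b : B}
    (hj : (j, b, Cost.base) ∈ firstRound q qPlus π A)
    (hi : (i, b, Cost.base) ∈ A \ firstRound q qPlus π A) : (π b).rel j i := by
  rw [Finset.mem_sdiff] at hi
  exact nativeRel_of_cost_eq (rel_of_mem_topIn hj (mem_baseContracts.2 ⟨hi.1, rfl⟩) hi.2 rfl)

theorem secondRound_rel {i j : I} {b : B} {t u : Cost}
    (hj : (j, b, t) ∈ secondRound q qPlus ω A) (hi : (i, b, u) ∈ rejects q qPlus ω A) :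
    (ω b).rel (j, t) (i, u) :=
  rel_of_mem_topIn hj (mem_rejects_iff.1 hi).1 (mem_rejects_iff.1 hi).2 rfl

theorem cost_of_mem_firstRound {x : Contract I B} (h : x ∈ firstRound q qPlus π A) :
    x.cost = Cost.base :=
  (mem_baseContracts.1 (firstRound_subset h)).2

theorem IsOfferSet.noPriorityReversals (h : IsOfferSet q qPlus ω P A)
    (hX : X.1 = complete q qPlus ω A) : X.NoPriorityReversals π P := by
  intro i j b t hj hr
  rw [hj] at hr
  have hi := h.mem_rejects_of_rel hX hr
  rw [X.assign_eq_some, hX] at hj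
  rcases Finset.mem_union.1 hj with hj | hj
  · have ht : t = Cost.base := cost_of_mem_firstRound hj
    subst ht
    exact firstRound_rel hj (mem_rejects_iff.1 hi).1
  · exact ((ω b).same_cost j i t).1 (secondRound_rel hj hi)

theorem IsOfferSet.enforcesPolicy [Fintype I] (h : IsOfferSet q qPlus ω P A)
    (hX : X.1 = complete q qPlus ω A) : X.EnforcesPolicy ω P := by
  classical
  intro b i j
  constructor
  · intro hi hr
    rw [X.assign_eq_some, hX] at hi
    refine secondRound_rel ((Finset.mem_union.1 hi).resolve_left fun hf => ?_)
      (h.mem_rejects_of_rel hX hr)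
    exact absurd (cost_of_mem_firstRound hf) (by simp)
  · intro hj hr hω
    have hi := h.mem_rejects_of_rel hX hr
    rw [X.assign_eq_some, hX] at hj
    have hj1 : (j, b, Cost.base) ∈ firstRound q qPlus π A :=
      (Finset.mem_union.1 hj).resolve_right fun hs => (ω b).asymm hω (secondRound_rel hs hi)
    have hcard : ((secondRound q qPlus ω A).filter fun x => x.branch = b).card = qPlus b :=
      card_topIn_of_notMem (x := (i, b, Cost.increased)) (mem_rejects_iff.1 hi).1
        (mem_rejects_iff.1 hi).2
    have hfilter : (X.1.filter fun x => x.2 = (b, Cost.increased)) =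
        (secondRound q qPlus ω A).filter fun x => x.branch = b := by
      rw [hX]
      ext ⟨k, c, t⟩
      simp only [Finset.mem_filter]
      constructor
      · rintro ⟨hx, heq⟩
        cases heq
        refine ⟨(Finset.mem_union.1 hx).resolve_left fun hf => ?_, rfl⟩
        exact absurd (cost_of_mem_firstRound hf) (by simp)
      · rintro ⟨hx, hb⟩
        cases hb
        refine ⟨Finset.mem_union_right _ hx, ?_⟩
        cases t with
        | increased => rfl
        | base =>
          have h1 := (ω c).trans (secondRound_rel hx hi) hω
          have h2 := firstRound_rel hj1 (secondRound_subset hx)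
          exact absurd (((ω c).same_cost k j Cost.base).1 h1) ((π c).asymm h2)
    have := X.card_filter_assign fun a => a = (b, Cost.increased)
    rw [hfilter, hcard] at this
    rw [this]
    congr 1
    ext k
    simp

end Mechanism

section StrategyProofness

variable {I B : Type*} [DecidableEq I] [DecidableEq B] [Fintype B]
variable {q qPlus : B → ℕ} {π : B → Ranking I} {ω : ∀ b, Policy (π b)}

/-- If more contracts are proposed for `P'` than for `P` and the preferences differ only for `i`,
who is matched for `P`, then she is matched for `P'`. -/
theorem IsOfferSet.matched_of_subset {P P' : I → Preference B} {A A' : Finset (Contract I B)}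
    (h : IsOfferSet q qPlus ω P A) (h' : IsOfferSet q qPlus ω P' A') (hA : A ⊆ A') {i : I}
    (hP : ∀ k, k ≠ i → P' k = P k) (hi : ∃ a, (i, a) ∈ complete q qPlus ω A) :
    ∃ a, (i, a) ∈ complete q qPlus ω A' := by
  by_contra hcon
  have hinj : ∀ {P A}, IsOfferSet q qPlus ω P A →
      Set.InjOn (fun x : Contract I B => x.1) (complete q qPlus ω A) := by
    rintro P A h ⟨j, a⟩ hx ⟨k, a'⟩ hy heq
    cases heq
    rw [h.justified.unique hx hy]
  have hlt : ((complete q qPlus ω A').image fun x => x.1).card <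
      ((complete q qPlus ω A).image fun x => x.1).card := by
    refine Finset.card_lt_card ((Finset.ssubset_iff_of_subset ?_).2 ⟨i, ?_, ?_⟩)
    · intro k hk
      obtain ⟨⟨k', a⟩, hx, rfl⟩ := Finset.mem_image.1 hk
      have hki : k' ≠ i := by
        rintro rfl
        exact hcon ⟨a, hx⟩
      have hacc := (h'.justified k' a (complete_subset hx)).1
      rw [hP k' hki] at hacc
      rcases h.exhausted k' a hacc with hr | ⟨a', ha'⟩
      · exact absurd hx (mem_rejects.1 (rejects_mono hA hr)).2
      · exact Finset.mem_image.2 ⟨_, ha', rfl⟩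
    · obtain ⟨a, ha⟩ := hi
      exact Finset.mem_image.2 ⟨_, ha, rfl⟩
    · intro hi'
      obtain ⟨⟨k', a⟩, hx, rfl⟩ := Finset.mem_image.1 hi'
      exact hcon ⟨a, hx⟩
  rw [Finset.card_image_of_injOn (hinj h'), Finset.card_image_of_injOn (hinj h)] at hlt
  exact absurd (card_complete_mono (q := q) (qPlus := qPlus) (ω := ω) hA) (not_le.2 hlt)

/-- A cadet who can obtain the acceptable pair `a` by some report obtains, when she reports the
truth, a pair that she likes at least as much. -/
theorem exists_weak_of_report [Fintype I] (ρ : Ranking I) {P : I → Preference B} {i : I}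
    {p : Preference B} {A A' : Finset (Contract I B)} (h : IsOfferSet q qPlus ω P A)
    (h' : IsOfferSet q qPlus ω (Function.update P i p) A') {a : B × Cost}
    (ha : (i, a) ∈ complete q qPlus ω A') (hacc : (P i).rel (some a) none) :
    ∃ a', (i, a') ∈ complete q qPlus ω A ∧ (P i).weak (some a') (some a) := by
  have base_weak : ∀ (r : Preference B) (b : B) (t : Cost),
      r.weak (some (b, Cost.base)) (some (b, t)) := by
    rintro r b (_ | _)
    · exact Or.inl rfl
    · exact Or.inr (r.base_better b)
  have weak_rel : ∀ (r : Preference B) {x y z}, r.weak x y → r.rel y z → r.rel x z := by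
    rintro r x y z (rfl | hxy) hyz
    · exact hyz
    · exact r.trans hxy hyz
  -- The report under which only `a` and its base cost version are acceptable.
  let E : Set (B × Cost) := {(a.1, Cost.base), a}
  have hE : ∀ b, (b, Cost.increased) ∈ E → (b, Cost.base) ∈ E := by
    rintro b (hb | hb)
    · exact absurd (Prod.ext_iff.1 hb).2 (by simp)
    · exact Or.inl (by rw [← show b = a.1 from (Prod.ext_iff.1 hb).1])
  obtain ⟨AE, hAE, -⟩ := exists_isOfferSet (q := q) (qPlus := qPlus) (ω := ω) ρ
    (Function.update P i ((P i).restrict E hE))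
  -- The truth, truncated below `a`.
  let T : Set (B × Cost) := {a' | (P i).weak (some a') (some a)}
  have hT : ∀ b, (b, Cost.increased) ∈ T → (b, Cost.base) ∈ T := by
    rintro b (hb | hb)
    · exact Or.inr (hb ▸ (P i).base_better b)
    · exact Or.inr ((P i).trans ((P i).base_better b) hb)
  obtain ⟨AT, hAT, -⟩ := exists_isOfferSet (q := q) (qPlus := qPlus) (ω := ω) ρ
    (Function.update P i ((P i).restrict T hT))
  have closed_E : ∀ {r : Preference B} {Z : Finset (Contract I B)},
      OfferClosed q qPlus ω (Function.update P i r) Z → (∀ a' ∈ E, (i, a') ∈ Z) →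
      OfferClosed q qPlus ω (Function.update P i ((P i).restrict E hE)) Z := by
    intro r Z hZ hEZ k a' hk hbetter
    by_cases hki : k = i
    · subst hki
      rw [Function.update_self, restrict_rel_none] at hk
      exact hEZ a' hk
    · rw [Function.update_of_ne hki] at hk hbetter
      refine hZ k a' ?_ ?_ <;> rwa [Function.update_of_ne hki]
  have hEA' : AE ⊆ A' := by
    refine hAE.least _ (closed_E h'.offerClosed ?_)
    have haA := complete_subset ha
    rintro a' (rfl | rfl)
    · rcases base_weak p a.1 a.2 with heq | hr
      · rwa [Option.some.inj heq]
      · refine rejects_subset ((h'.justified i a haA).2 _ ?_)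
        rwa [Function.update_self]
    · exact haA
  have hmatchE : ∃ a', (i, a') ∈ complete q qPlus ω AE := by
    refine (hAE.exhausted i a ?_).resolve_left fun hr => ?_
    · rw [Function.update_self, restrict_rel_none]
      exact Or.inr rfl
    · exact (mem_rejects.1 (rejects_mono hEA' hr)).2 ha
  obtain ⟨y, hy⟩ : ∃ y, (i, y) ∈ complete q qPlus ω AT := by
    by_contra hcon
    have hrej : ∀ a' ∈ T, (i, a') ∈ rejects q qPlus ω AT := by
      intro a' ha'
      refine (hAT.exhausted i a' ?_).resolve_right hcon
      rwa [Function.update_self, restrict_rel_none]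
    have hET : AE ⊆ AT := by
      refine hAE.least _ (closed_E hAT.offerClosed ?_)
      rintro a' (rfl | rfl)
      · exact rejects_subset (hrej _ (base_weak (P i) a.1 a.2))
      · exact rejects_subset (hrej _ (Or.inl rfl))
    refine hcon (hAE.matched_of_subset hAT hET (i := i) (fun k hk => ?_) hmatchE)
    rw [Function.update_of_ne hk, Function.update_of_ne hk]
  have hyT : y ∈ T := by
    have := (hAT.justified i y (complete_subset hy)).1
    rwa [Function.update_self, restrict_rel_none] at this
  have hAAT : A ⊆ AT := by
    refine h.least _ fun k z hz hbetter => ?_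
    by_cases hki : k = i
    · subst hki
      have hzT : z ∈ T := by
        by_cases hzy : z = y
        · exact hzy ▸ hyT
        · rcases (P k).total (fun h => hzy (Option.some.inj h)) with hr | hr
          · exact Or.inr (by
              rcases hyT with heq | hr'
              · exact heq ▸ hr
              · exact (P k).trans hr hr')
          · exact absurd hy (mem_rejects.1 (hbetter y hr)).2
      refine hAT.offerClosed k z ?_ ?_
      · rwa [Function.update_self, restrict_rel_none]
      · intro a' ha'
        rw [Function.update_self, restrict_rel_some hzT] at ha'
        exact hbetter a' ha'.2
    · refine hAT.offerClosed k z ?_ ?_ <;> rwa [Function.update_of_ne hki]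
  have hy_acc : (P i).rel (some y) none := weak_rel _ hyT hacc
  have hyr : (i, y) ∉ rejects q qPlus ω A := fun hr => (mem_rejects.1 (rejects_mono hAAT hr)).2 hy
  obtain ⟨z, hz⟩ := (h.exhausted i y hy_acc).resolve_left hyr
  refine ⟨z, hz, ?_⟩
  by_cases hzy : z = y
  · exact hzy ▸ hyT
  · rcases (P i).total (fun h => hzy (Option.some.inj h)) with hr | hr
    · rcases hyT with heq | hr'
      · exact Or.inr (heq ▸ hr)
      · exact Or.inr ((P i).trans hr hr')
    · exact absurd ((h.justified i z (complete_subset hz)).2 y hr) hyr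

end StrategyProofness

section Uniqueness

variable {I B : Type*} [Fintype I] [DecidableEq I] [DecidableEq B]
variable {q qPlus : B → ℕ} {π : B → Ranking I} {ω : ∀ b, Policy (π b)}
variable {P : I → Preference B} {X Y : Allocation I q qPlus}

/-- Every cadet whose assignments in `X` and `Y` differ is unmatched in one of them and has an
acceptable assignment in the other. -/
def DifferByUnmatched (P : I → Preference B) (X Y : Allocation I q qPlus) : Prop :=
  ∀ i, X.assign i = Y.assign i ∨
    (Y.assign i = none ∧ (P i).rel (X.assign i) none) ∨
    (X.assign i = none ∧ (P i).rel (Y.assign i) none)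

theorem DifferByUnmatched.symm (h : DifferByUnmatched P X Y) : DifferByUnmatched P Y X :=
  fun i => (h i).imp Eq.symm Or.symm

theorem DifferByUnmatched.rel_none (h : DifferByUnmatched P X Y) {i : I} {a : B × Cost}
    (hX : X.assign i = some a) (hY : Y.assign i = none) : (P i).rel (some a) none := by
  rcases h i with h | ⟨-, h⟩ | ⟨h, -⟩
  · rw [hX, hY] at h
    exact absurd h (by simp)
  · rwa [hX] at h
  · rw [hX] at h
    exact absurd h (by simp)

theorem not_same_cost (h : DifferByUnmatched P X Y) (hX : X.NoPriorityReversals π P)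
    (hY : Y.NoPriorityReversals π P) {i j : I} {b : B} {t : Cost}
    (hXi : X.assign i = some (b, t)) (hYi : Y.assign i = none)
    (hYj : Y.assign j = some (b, t)) (hXj : X.assign j = none) : False := by
  have h1 := hX j i b t hXi (by rw [hXi, hXj]; exact h.symm.rel_none hYj hXj)
  have h2 := hY i j b t hYj (by rw [hYj, hYi]; exact h.rel_none hXi hYi)
  exact (π b).asymm h1 h2

theorem card_increased_le (X : Allocation I q qPlus) (b : B) :
    (Finset.univ.filter fun k => X.assign k = some (b, Cost.increased)).card ≤ qPlus b := by
  classical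
  have h := X.card_filter_assign fun a => a = (b, Cost.increased)
  refine le_trans (le_of_eq ?_) (X.2.increased_le b)
  trans (X.1.filter fun x => x.2 = (b, Cost.increased)).card
  · rw [h]
    congr 1
    ext k
    simp
  · congr 1
    ext x
    simp [Prod.ext_iff]

theorem not_base_increased (h : DifferByUnmatched P X Y) (hX : X.NoPriorityReversals π P)
    (hY : Y.NoPriorityReversals π P) (hXe : X.EnforcesPolicy ω P) (hYe : Y.EnforcesPolicy ω P)
    {i j : I} {b : B} (hXi : X.assign i = some (b, Cost.base)) (hYi : Y.assign i = none)
    (hYj : Y.assign j = some (b, Cost.increased)) (hXj : X.assign j = none) : False := by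
  classical
  have hω := (hYe b j i).1 hYj (by rw [hYi]; exact h.rel_none hXi hYi)
  have hcard := (hXe b j i).2 hXi (by rw [hXj]; exact h.symm.rel_none hYj hXj) hω
  refine absurd (card_increased_le Y b) (not_le.2 ?_)
  rw [← hcard]
  refine Finset.card_lt_card ((Finset.ssubset_iff_of_subset ?_).2 ⟨j, by simp [hYj], by simp [hXj]⟩)
  intro k hk
  have hXk := (Finset.mem_filter.1 hk).2
  refine Finset.mem_filter.2 ⟨Finset.mem_univ _, ?_⟩
  rcases h k with heq | ⟨hYk, -⟩ | ⟨hXk', -⟩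
  · rw [← heq, hXk]
  · exact (not_same_cost h hX hY hXk hYk hYj hXj).elim
  · rw [hXk] at hXk'
    exact absurd hXk' (by simp)

theorem exists_opposite (h : DifferByUnmatched P X Y) (hY : Y.NonWasteful P) {i : I} {b : B}
    {t : Cost} (hXi : X.assign i = some (b, t)) (hYi : Y.assign i = none) :
    ∃ j u, Y.assign j = some (b, u) ∧ X.assign j = none := by
  classical
  by_contra! hcon
  have hcard : q b ≤ (Y.1.filter fun x => x.branch = b).card := by
    by_contra hlt
    have h1 := hY b i (not_le.1 hlt) hYi
    have h2 := h.rel_none hXi hYi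
    cases t with
    | base => exact (P i).asymm h1 h2
    | increased => exact (P i).asymm h1 ((P i).trans ((P i).base_better b) h2)
  have h1 := X.card_filter_assign fun a => a.1 = b
  have h2 := Y.card_filter_assign fun a => a.1 = b
  have hlt : (Finset.univ.filter fun k => ∃ a, Y.assign k = some a ∧ a.1 = b).card <
      (Finset.univ.filter fun k => ∃ a, X.assign k = some a ∧ a.1 = b).card := by
    refine Finset.card_lt_card ((Finset.ssubset_iff_of_subset ?_).2
      ⟨i, by simp [hXi], by simp [hYi]⟩)
    intro k hk
    obtain ⟨⟨c, u⟩, hYk, hc⟩ := (Finset.mem_filter.1 hk).2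
    dsimp only at hc
    subst hc
    refine Finset.mem_filter.2 ⟨Finset.mem_univ _, ?_⟩
    rcases h k with heq | ⟨hYk', -⟩ | ⟨hXk, -⟩
    · exact ⟨_, heq.trans hYk, rfl⟩
    · rw [hYk] at hYk'
      exact absurd hYk' (by simp)
    · exact absurd hXk (hcon k u hYk)
  have h3 := X.2.branch_le b
  rw [← h1, ← h2] at hlt
  exact absurd (hcard.trans_lt (hlt.trans_le h3)) (lt_irrefl _)

theorem DifferByUnmatched.eq_none (h : DifferByUnmatched P X Y)
    (hX : X.NoPriorityReversals π P) (hY : Y.NoPriorityReversals π P)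
    (hXe : X.EnforcesPolicy ω P) (hYe : Y.EnforcesPolicy ω P) (hYw : Y.NonWasteful P) {i : I}
    (hYi : Y.assign i = none) : X.assign i = none := by
  cases hXi : X.assign i with
  | none => rfl
  | some a =>
    obtain ⟨b, t⟩ := a
    obtain ⟨j, u, hYj, hXj⟩ := exists_opposite h hYw hXi hYi
    exfalso
    cases t <;> cases u
    · exact not_same_cost h hX hY hXi hYi hYj hXj
    · exact not_base_increased h hX hY hXe hYe hXi hYi hYj hXj
    · exact not_base_increased h.symm hY hX hYe hXe hYj hXj hXi hYi
    · exact not_same_cost h hX hY hXi hYi hYj hXj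

theorem DifferByUnmatched.eq (h : DifferByUnmatched P X Y)
    (hX : X.NoPriorityReversals π P) (hY : Y.NoPriorityReversals π P)
    (hXe : X.EnforcesPolicy ω P) (hYe : Y.EnforcesPolicy ω P)
    (hXw : X.NonWasteful P) (hYw : Y.NonWasteful P) : X.1 = Y.1 := by
  have hassign : ∀ i, X.assign i = Y.assign i := by
    intro i
    rcases h i with heq | ⟨hYi, -⟩ | ⟨hXi, -⟩
    · exact heq
    · rw [hYi, h.eq_none hX hY hXe hYe hYw hYi]
    · rw [hXi, h.symm.eq_none hY hX hYe hXe hXw hXi]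
  ext ⟨i, a⟩
  rw [← X.assign_eq_some, ← Y.assign_eq_some, hassign]

open Classical in
/-- The number of acceptable branch-cost pairs. -/
noncomputable def acceptCount [Fintype B] (p : Preference B) : ℕ :=
  (Finset.univ.filter fun a : B × Cost => p.rel (some a) none).card

theorem unmatched_of_minimal [Fintype B] {φ ψ : DirectMechanism I q qPlus}
    (hψr : ψ.IndividuallyRational) (hφs : φ.StrategyProof)
    (hψs : ψ.StrategyProof) {P : I → Preference B} {i : I}
    (hmin : ∀ p, acceptCount p < acceptCount (P i) →
      (φ (Function.update P i p)).assign i = (ψ (Function.update P i p)).assign i)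
    (hr : (P i).rel ((φ P).assign i) ((ψ P).assign i)) :
    (ψ P).assign i = none ∧ (P i).rel ((φ P).assign i) none := by
  classical
  have hφacc : (P i).rel ((φ P).assign i) none := by
    rcases hψr P i with h | h
    · rwa [h] at hr
    · exact (P i).trans hr h
  refine ⟨?_, hφacc⟩
  cases hφi : (φ P).assign i with
  | none =>
    rw [hφi] at hφacc
    exact absurd hφacc ((P i).irrefl _)
  | some a =>
  rw [hφi] at hr hφacc
  let E : Set (B × Cost) := {(a.1, Cost.base), a}
  have hE : ∀ b, (b, Cost.increased) ∈ E → (b, Cost.base) ∈ E := by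
    rintro b (hb | hb)
    · exact absurd (Prod.ext_iff.1 hb).2 (by simp)
    · exact Or.inl (by rw [← show b = a.1 from (Prod.ext_iff.1 hb).1])
  have hEweak : ∀ a' ∈ E, a' = a ∨ (P i).rel (some a') (some a) := by
    obtain ⟨b, t⟩ := a
    rintro a' (rfl | rfl)
    · cases t
      · exact Or.inl rfl
      · exact Or.inr ((P i).base_better b)
    · exact Or.inl rfl
  have hEacc : ∀ a' ∈ E, (P i).rel (some a') none := by
    intro a' ha'
    rcases hEweak a' ha' with rfl | h
    · exact hφacc
    · exact (P i).trans h hφacc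
  have hsubset : (Finset.univ.filter fun a' =>
      ((P i).restrict E hE).rel (some a') none) ⊆
      Finset.univ.filter fun a' => (P i).rel (some a') none := by
    intro a' ha'
    rw [Finset.mem_filter, restrict_rel_none] at ha'
    exact Finset.mem_filter.2 ⟨Finset.mem_univ _, hEacc a' ha'.2⟩
  cases hψi : (ψ P).assign i with
  | none => rfl
  | some a₀ =>
  exfalso
  rw [hψi] at hr
  have ha₀ : (P i).rel (some a₀) none := by
    have := hψr P i
    rw [hψi] at this
    exact this.resolve_left (by simp)
  have ha₀E : a₀ ∉ E := by
    intro h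
    rcases hEweak a₀ h with rfl | h
    · exact (P i).irrefl _ hr
    · exact (P i).asymm hr h
  have heq := hmin ((P i).restrict E hE) (by
    refine Finset.card_lt_card ((Finset.ssubset_iff_of_subset hsubset).2 ⟨a₀, ?_, ?_⟩)
    · exact Finset.mem_filter.2 ⟨Finset.mem_univ _, ha₀⟩
    · rw [Finset.mem_filter, restrict_rel_none]
      exact fun h => ha₀E h.2)
  set P' := Function.update P i ((P i).restrict E hE) with hP'
  have hP'i : P' i = (P i).restrict E hE := Function.update_self _ _ _
  have hφ' := hφs P' i (P i)
  rw [hP', Function.update_idem, Function.update_eq_self, ← hP', hφi, hP'i] at hφ'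
  have hne : (ψ P').assign i ≠ none := by
    rw [← heq]
    intro hnone
    rw [hnone] at hφ'
    have hrel : ((P i).restrict E hE).rel (some a) none := restrict_rel_none.2 (Or.inr rfl)
    exact ((P i).restrict E hE).asymm hrel (hφ'.resolve_left (by simp))
  obtain ⟨a', ha'⟩ := Option.ne_none_iff_exists'.1 hne
  have ha'E : a' ∈ E := by
    have := (hψr P' i).resolve_left hne
    rwa [ha', hP'i, restrict_rel_none] at this
  have hψ' := hψs P i ((P i).restrict E hE)
  rw [← hP', hψi, ha'] at hψ'
  have hlt : (P i).rel (some a') (some a₀) := by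
    rcases hEweak a' ha'E with rfl | h
    · exact hr
    · exact (P i).trans h hr
  rcases hψ' with h | h
  · rw [h] at hlt
    exact (P i).irrefl _ hlt
  · exact (P i).asymm h hlt

theorem mechanism_unique [Fintype B] {φ ψ : DirectMechanism I q qPlus}
    (hφ : φ.IndividuallyRational ∧ φ.NonWasteful ∧ φ.EnforcesPolicy ω ∧ φ.StrategyProof ∧
      φ.NoPriorityReversals π)
    (hψ : ψ.IndividuallyRational ∧ ψ.NonWasteful ∧ ψ.EnforcesPolicy ω ∧ ψ.StrategyProof ∧
      ψ.NoPriorityReversals π) (P : I → Preference B) : (φ P).1 = (ψ P).1 := by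
  obtain ⟨hφr, hφw, hφe, hφs, hφn⟩ := hφ
  obtain ⟨hψr, hψw, hψe, hψs, hψn⟩ := hψ
  induction hm : ∑ k, acceptCount (P k) using Nat.strong_induction_on generalizing P with
  | _ m ih =>
  have hmin : ∀ i p, acceptCount p < acceptCount (P i) →
      φ (Function.update P i p) = ψ (Function.update P i p) := by
    intro i p hp
    refine Subtype.ext (ih _ ?_ _ rfl)
    rw [← hm]
    refine Finset.sum_lt_sum (fun k _ => ?_) ⟨i, Finset.mem_univ _, by simpa using hp⟩
    by_cases hk : k = i
    · subst hk
      simpa using hp.le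
    · rw [Function.update_of_ne hk]
  have hdiff : DifferByUnmatched P (φ P) (ψ P) := by
    intro i
    by_cases heq : (φ P).assign i = (ψ P).assign i
    · exact Or.inl heq
    · rcases (P i).total heq with h | h
      · exact Or.inr (Or.inl (unmatched_of_minimal hψr hφs hψs
          (fun p hp => by rw [hmin i p hp]) h))
      · exact Or.inr (Or.inr (unmatched_of_minimal hφr hψs hφs
          (fun p hp => by rw [hmin i p hp]) h))
  exact hdiff.eq (hφn P) (hψn P) (hφe P) (hψe P) (hφw P) (hψw P)

end Uniqueness

section Characterization

variable {I B : Type*} [Fintype I] [DecidableEq I] [Fintype B] [DecidableEq B]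
variable {q qPlus : B → ℕ} {π : B → Ranking I}

theorem isAllocation_comBradso (hq : ∀ b, qPlus b ≤ q b) (ω : ∀ b, Policy (π b))
    (ρ : Ranking I) (P : I → Preference B) :
    IsAllocation q qPlus (comBradso q qPlus ω ρ P) := by
  obtain ⟨A, hA, hcom⟩ := exists_isOfferSet (q := q) (qPlus := qPlus) (ω := ω) ρ P
  rw [hcom]
  exact isAllocation_complete hq hA.justified

/-- COM-BRADSO as a direct mechanism. -/
noncomputable def comMechanism (hq : ∀ b, qPlus b ≤ q b) (ω : ∀ b, Policy (π b))
    (ρ : Ranking I) : DirectMechanism I q qPlus :=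
  fun P => ⟨comBradso q qPlus ω ρ P, isAllocation_comBradso hq ω ρ P⟩

theorem comMechanism_strategyProof (hq : ∀ b, qPlus b ≤ q b) (ω : ∀ b, Policy (π b))
    (ρ : Ranking I) : (comMechanism hq ω ρ).StrategyProof := by
  intro P i p
  obtain ⟨A, hA, hcom⟩ := exists_isOfferSet (q := q) (qPlus := qPlus) (ω := ω) ρ P
  obtain ⟨A', hA', hcom'⟩ := exists_isOfferSet (q := q) (qPlus := qPlus) (ω := ω) ρ
    (Function.update P i p)
  have hX : (comMechanism hq ω ρ P).1 = complete q qPlus ω A := hcom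
  have hX' : (comMechanism hq ω ρ (Function.update P i p)).1 = complete q qPlus ω A' := hcom'
  have hir := hA.individuallyRational hX i
  cases hi : (comMechanism hq ω ρ (Function.update P i p)).assign i with
  | none => exact hir
  | some a =>
    by_cases hacc : (P i).rel (some a) none
    · rw [Allocation.assign_eq_some, hX'] at hi
      obtain ⟨a', ha', hw⟩ := exists_weak_of_report ρ hA hA' hi hacc
      rw [← hX, ← Allocation.assign_eq_some] at ha'
      rwa [ha']
    · have hna : (P i).rel none (some a) := ((P i).total (by simp)).resolve_right hacc
      rcases hir with h | h
      · exact Or.inr (h ▸ hna)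
      · exact Or.inr ((P i).trans h hna)

theorem comMechanism_axioms (hq : ∀ b, qPlus b ≤ q b) (ω : ∀ b, Policy (π b))
    (ρ : Ranking I) :
    (comMechanism hq ω ρ).IndividuallyRational ∧ (comMechanism hq ω ρ).NonWasteful ∧
      (comMechanism hq ω ρ).EnforcesPolicy ω ∧ (comMechanism hq ω ρ).StrategyProof ∧
      (comMechanism hq ω ρ).NoPriorityReversals π := by
  have key := fun P => exists_isOfferSet (q := q) (qPlus := qPlus) (ω := ω) ρ P
  choose A hA hcom using key
  exact ⟨fun P => (hA P).individuallyRational (hcom P), fun P => (hA P).nonWasteful hq (hcom P),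
    fun P => (hA P).enforcesPolicy (hcom P), comMechanism_strategyProof hq ω ρ,
    fun P => (hA P).noPriorityReversals (hcom P)⟩

end Characterization

end Bradso

theorem theorem2 {I B : Type*} [Fintype I] [DecidableEq I] [Fintype B] [DecidableEq B]
    (q qPlus : B → ℕ) (hq : ∀ b, qPlus b ≤ q b)
    (π : B → Bradso.Ranking I) (ω : ∀ b, Bradso.Policy (π b)) (ρ : Bradso.Ranking I) :
    (∀ P : I → Bradso.Preference B,
      Bradso.IsAllocation q qPlus (Bradso.comBradso q qPlus ω ρ P)) ∧
    ∀ φ : Bradso.DirectMechanism I q qPlus,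
      (φ.IndividuallyRational ∧ φ.NonWasteful ∧ φ.EnforcesPolicy ω ∧ φ.StrategyProof ∧
          φ.NoPriorityReversals π) ↔
        ∀ P : I → Bradso.Preference B, (φ P).1 = Bradso.comBradso q qPlus ω ρ P := by
  refine ⟨Bradso.isAllocation_comBradso hq ω ρ, fun φ => ⟨fun h P => ?_, fun h => ?_⟩⟩
  · exact Bradso.mechanism_unique h (Bradso.comMechanism_axioms hq ω ρ) P
  · have : φ = Bradso.comMechanism hq ω ρ := funext fun P => Subtype.ext (h P)
    rw [this]
    exact Bradso.comMechanism_axioms hq ω ρ
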